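/- Let $f:\mathbb{R}^n\times\mathbb{R}^p\times\mathbb{Z}_{\ge 0}\to\mathbb{R}^n$, let $\mathcal{X}_0\subseteq\mathbb{R}^n$ (initial set) and $\mathcal{U}\subseteq\mathbb{R}^p$ (input set), and consider the stochastic system $X_{t+1}=f(X_t,u_t,t)+w_t$ and the deterministic system $x_{t+1}=f(x_t,u_t,t)$. Let $\|\cdot\|$ be the Euclidean norm. Suppose that (i) for every $t\ge 0$ there is a constant $L_t\ge 0$ with $\|f(x,u,t)-f(y,u,t)\|\le L_t\|x-y\|$ for all $x,y\in\mathbb{R}^n$ and $u\in\mathbb{R}^p$; (ii) the disturbances $w_0,w_1,\dots$ are mutually independent $\mathbb{R}^n$-valued random vectors, and each $w_t$ is sub-Gaussian with variance proxy $\sigma_t^2$ for some finite $\sigma_t\ge 0$, that is, $\mathbb{E}(w_t)=0$ and $\mathbb{E}\,e^{\lambda\langle \ell,w_t\rangle}\le e^{\lambda^2\sigma_t^2/2}$ for all $\lambda\in\mathbb{R}$ and all unit vectors $\ell\in\mathbb{R}^n$. For $t\in\mathbb{Z}_{\ge 0}$ let $\mathcal{R}_t$ be the deterministic reachable set, i.e.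 the set of all $x_t$ where $\tau\mapsto x_\tau$ is a trajectory of the deterministic system with $x_0\in\mathcal{X}_0$ and inputs $u_\tau\in\mathcal{U}$ for all $\tau\ge0$, and let $\overline{\mathcal{R}}_t\subseteq\mathbb{R}^n$ be any set with $\mathcal{R}_t\subseteq\overline{\mathcal{R}}_t$. Let $\delta\in(0,1]$, $\varepsilon\in(0,1)$, and put $$r_{\delta,t}=\sqrt{\Psi_t\left(\varepsilon_1 n+\varepsilon_2\log(1/\delta)\right)},\qquad \varepsilon_1=\frac{2\log(1+2/\varepsilon)}{(1-\varepsilon)^2},\qquad \varepsilon_2=\frac{2}{(1-\varepsilon)^2},$$ $$\Psi_t=\sum_{k=0}^{t-1}\sigma_k^2\prod_{j=k+1}^{t-1}L_j^2,$$ which equals $\psi_{t-1}\sum_{k=0}^{t-1}\sigma_k^2\psi_k^{-1}$ with $\psi_t=\prod_{k=0}^{t}L_k^2$ if all $L_k>0$. Then $\overline{\mathcal{R}}_t\oplus\{x\in\mathbb{R}^n:\|x\|\le r_{\delta,t}\}$ (Minkowski sum) is a $\delta$-probabilistic reachable set of the stochastic system at time $t$: for every $x_0\in\mathcal{X}_0$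 and every input sequence $u:\mathbb{Z}_{\ge 0}\to\mathcal{U}$, the solution of the stochastic system with $X_0=x_0$ and input $u$ satisfies $$\mathbb{P}\left(X_t\in\overline{\mathcal{R}}_t\oplus\{x:\|x\|\le r_{\delta,t}\}\right)\ge 1-\delta .$$ (If this event is not measurable, the claim is that it contains a measurable event of probability at least $1-\delta$.) -/

import Mathlib

open MeasureTheory ProbabilityTheory
open scoped Pointwise

namespace StochReach

noncomputable section

/-- The Euclidean space `ℝⁿ`. -/
abbrev E (n : ℕ) : Type := EuclideanSpace ℝ (Fin n)

/-- `τ ↦ x τ` is a trajectory of the deterministic system `x_{τ+1} = f (x_τ, u_τ, τ)`. -/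
def IsDetTrajectory {n p : ℕ} (f : E n → E p → ℕ → E n) (u : ℕ → E p) (x : ℕ → E n) : Prop :=
  ∀ τ, x (τ + 1) = f (x τ) (u τ) τ

/-- The deterministic reachable set at time `t`, from initial states in `X₀`, with inputs in `U`. -/
def detReachSet {n p : ℕ} (f : E n → E p → ℕ → E n) (X₀ : Set (E n)) (U : Set (E p)) (t : ℕ) :
    Set (E n) :=
  {y | ∃ (x : ℕ → E n) (u : ℕ → E p),
      IsDetTrajectory f u x ∧ x 0 ∈ X₀ ∧ (∀ τ, u τ ∈ U) ∧ x t = y}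

/-- The trajectory `X_{t+1} = f (X_t, u_t, t) + w_t` of the stochastic system with the
(deterministic) initial state `x₀`, the input `u` and the disturbance `w`. -/
def stochTrajectory {Ω : Type*} {n p : ℕ} (f : E n → E p → ℕ → E n) (w : ℕ → Ω → E n)
    (u : ℕ → E p) (x₀ : E n) : ℕ → Ω → E n
  | 0, _ => x₀
  | t + 1, ω => f (stochTrajectory f w u x₀ t ω) (u t) t + w t ω

/-- The random vector `X` is sub-Gaussian with variance proxy `v`: it has mean zero and
`𝔼 exp (a ⟪ℓ, X⟫) ≤ exp (a² v / 2)` for all real `a` and all unit vectors `ℓ`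
(both expectations being finite). -/
structure IsSubGaussian {Ω : Type*} [MeasurableSpace Ω] {n : ℕ} (X : Ω → E n) (v : ℝ)
    (μ : Measure Ω) : Prop where
  measurable : Measurable X
  integrable : Integrable X μ
  mean_zero : ∫ ω, X ω ∂μ = 0
  integrable_exp : ∀ (a : ℝ) (l : E n), ‖l‖ = 1 →
    Integrable (fun ω => Real.exp (a * inner ℝ l (X ω))) μ
  mgf_le : ∀ (a : ℝ) (l : E n), ‖l‖ = 1 →
    ∫ ω, Real.exp (a * inner ℝ l (X ω)) ∂μ ≤ Real.exp (a ^ 2 * v / 2)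

/-- `R` is a `δ`-probabilistic reachable set at time `t` of the stochastic system: for every
initial state in `X₀` and every input sequence in `U`, the state lies in `R` with probability at
least `1 - δ`. As `R` need not be measurable, this is asked in the strong sense that `X_t ∈ R`
holds on a measurable event of probability at least `1 - δ`. -/
def IsProbReachSet {Ω : Type*} [MeasurableSpace Ω] {n p : ℕ} (μ : Measure Ω)
    (f : E n → E p → ℕ → E n) (w : ℕ → Ω → E n) (X₀ : Set (E n)) (U : Set (E p))
    (δ : ℝ) (t : ℕ) (R : Set (E n)) : Prop :=
  ∀ x₀ ∈ X₀, ∀ u : ℕ → E p, (∀ τ, u τ ∈ U) →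
    ∃ A : Set Ω, MeasurableSet A ∧ A ⊆ {ω | stochTrajectory f w u x₀ t ω ∈ R} ∧
      1 - δ ≤ μ.real A

/-- When the events `X_t ∈ R` are measurable, this is `ℙ (X_t ∈ R) ≥ 1 - δ`. -/
theorem isProbReachSet_iff {Ω : Type*} [MeasurableSpace Ω] {n p : ℕ} (μ : Measure Ω)
    [IsProbabilityMeasure μ] (f : E n → E p → ℕ → E n) (w : ℕ → Ω → E n) (X₀ : Set (E n))
    (U : Set (E p)) (δ : ℝ) (t : ℕ) (R : Set (E n))
    (hR : ∀ (x₀ : E n) (u : ℕ → E p), MeasurableSet {ω | stochTrajectory f w u x₀ t ω ∈ R}) :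
    IsProbReachSet μ f w X₀ U δ t R ↔
      ∀ x₀ ∈ X₀, ∀ u : ℕ → E p, (∀ τ, u τ ∈ U) →
        1 - δ ≤ μ.real {ω | stochTrajectory f w u x₀ t ω ∈ R} := by
  constructor
  · intro h x₀ hx u hu
    obtain ⟨A, -, hA, h1⟩ := h x₀ hx u hu
    exact h1.trans (measureReal_mono hA)
  · intro h x₀ hx u hu
    exact ⟨_, hR x₀ u, subset_rfl, h x₀ hx u hu⟩

/-- `ψ_t = ∏_{k=0}^{t} L_k²`. -/
def psi (L : ℕ → ℝ) (t : ℕ) : ℝ := ∏ k ∈ Finset.range (t + 1), L k ^ 2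

/-- `Ψ_t = ψ_{t-1} ∑_{k=0}^{t-1} σ_k² ψ_k⁻¹`, written with the quotients `ψ_{t-1} / ψ_k` cancelled,
so that it is also meaningful if some `L_k` vanish: `Ψ_t = ∑_{k<t} σ_k² ∏_{k<j<t} L_j²`. -/
def Psi (L σ : ℕ → ℝ) (t : ℕ) : ℝ :=
  ∑ k ∈ Finset.range t, σ k ^ 2 * ∏ j ∈ Finset.Ico (k + 1) t, L j ^ 2

/-- `Ψ_t = ψ_{t-1} ∑_{k=0}^{t-1} σ_k² ψ_k⁻¹` if the `L_k` do not vanish. -/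
theorem Psi_eq (L σ : ℕ → ℝ) (hL : ∀ k, L k ≠ 0) (t : ℕ) :
    Psi L σ t = psi L (t - 1) * ∑ k ∈ Finset.range t, σ k ^ 2 * (psi L k)⁻¹ := by
  unfold Psi
  rw [Finset.mul_sum]
  refine Finset.sum_congr rfl fun k hk => ?_
  have hkt : k + 1 ≤ t := Finset.mem_range.mp hk
  have h0 : psi L k ≠ 0 := Finset.prod_ne_zero_iff.mpr fun i _ => pow_ne_zero _ (hL i)
  have h1 : psi L k * ∏ j ∈ Finset.Ico (k + 1) t, L j ^ 2 = psi L (t - 1) := by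
    unfold psi
    rw [Finset.prod_range_mul_prod_Ico _ hkt, Nat.sub_add_cancel (by omega)]
  rw [← h1]
  field_simp

/-- `ε₁ = 2 log (1 + 2/ε) / (1 - ε)²`. -/
def eps₁ (ε : ℝ) : ℝ := 2 * Real.log (1 + 2 / ε) / (1 - ε) ^ 2

/-- `ε₂ = 2 / (1 - ε)²`. -/
def eps₂ (ε : ℝ) : ℝ := 2 / (1 - ε) ^ 2

/-- `r_{δ,t} = √(Ψ_t (ε₁ n + ε₂ log (1/δ)))`. -/
def radius (n : ℕ) (L σ : ℕ → ℝ) (ε δ : ℝ) (t : ℕ) : ℝ :=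
  Real.sqrt (Psi L σ t * (eps₁ ε * n + eps₂ ε * Real.log (1 / δ)))

end

end StochReach

namespace StochReach

/-! Let `V_t` be the deviation of the stochastic state from the deterministic trajectory with the
same initial state and input. A nonlinear `f` need not preserve moment generating function bounds in
a fixed direction, so the exponential is averaged over all directions, written as `x / ‖x‖` with `x`
in the unit ball. The average `Φ = directionMGF` depends only on `‖v‖` and increases with it
(`directionMGF_mono`). A Lipschitz step therefore costs only the factor `L_t` in the argument, and
independent noise costs `exp (a² σ_t² / 2)` (`lintegral_directionMGF_add_le`). By induction, `𝔼 Φ(a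
V_t) ≤ exp (a² Ψ_t / 2) vol(B)`, with `B` the unit ball.

Conversely, a small ball of points whose directions are close to `v` gives `Φ(v) ≥ exp ((1-ε)‖v‖)
(1+2/ε)⁻ⁿ vol(B)` (`le_directionMGF`). Markov's inequality with the best `a` yields the tail bound
for `‖V_t‖`. -/

/-- The moment generating function, at `v`, of the direction `x / ‖x‖` of a point `x` of the unit
ball, with respect to the (unnormalized) Lebesgue measure. -/
noncomputable def directionMGF {n : ℕ} (v : E n) : ENNReal :=
  ∫⁻ x in Metric.closedBall (0 : E n) 1, ENNReal.ofReal (Real.exp (inner ℝ (‖x‖⁻¹ • x) v))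

/-! ### Rotation invariance and monotonicity of the averaged exponential -/

theorem measurable_direction {n : ℕ} : Measurable fun x : E n => ‖x‖⁻¹ • x :=
  measurable_norm.inv.smul measurable_id

theorem measurable_exp_direction {α : Type*} [MeasurableSpace α] {n : ℕ} {g h : α → E n}
    (hg : Measurable g) (hh : Measurable h) :
    Measurable fun q => ENNReal.ofReal (Real.exp (inner ℝ (‖g q‖⁻¹ • g q) (h q))) :=
  (Real.measurable_exp.comp ((measurable_direction.comp hg).inner hh)).ennreal_ofReal

theorem measurable_directionMGF {n : ℕ} : Measurable (directionMGF (n := n)) :=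
  Measurable.lintegral_prod_left' (f := fun q : E n × E n =>
    ENNReal.ofReal (Real.exp (inner ℝ (‖q.1‖⁻¹ • q.1) q.2)))
    (measurable_exp_direction measurable_fst measurable_snd)

theorem directionMGF_isometry {n : ℕ} (e : E n ≃ₗᵢ[ℝ] E n) (v : E n) :
    directionMGF (e v) = directionMGF v := by
  unfold directionMGF
  have h := (e.measurePreserving).setLIntegral_comp_preimage_emb
    e.toHomeomorph.measurableEmbedding
    (fun x => ENNReal.ofReal (Real.exp (inner ℝ (‖x‖⁻¹ • x) (e v))))
    (Metric.closedBall (0 : E n) 1)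
  rw [← h]
  have hball : e ⁻¹' Metric.closedBall (0 : E n) 1 = Metric.closedBall 0 1 := by
    ext x; simp
  rw [hball]
  refine lintegral_congr fun x => ?_
  rw [e.norm_map, ← e.map_smul, e.inner_map_map]

/-- The reflection in the hyperplane orthogonal to `v - v'` exchanges two vectors of equal norm. -/
theorem directionMGF_eq_of_norm_eq {n : ℕ} {v v' : E n} (h : ‖v‖ = ‖v'‖) :
    directionMGF v = directionMGF v' := by
  rw [← Submodule.reflection_sub h]
  exact (directionMGF_isometry _ v).symm

/-- Averaging over `v` and `-v` replaces `exp` by `cosh`, which increases with the absolute value of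
its argument; scaling can then be compared pointwise. -/
theorem two_mul_directionMGF {n : ℕ} (v : E n) :
    2 * directionMGF v = ∫⁻ x in Metric.closedBall (0 : E n) 1,
      ENNReal.ofReal (2 * Real.cosh (inner ℝ (‖x‖⁻¹ • x) v)) := by
  have hneg : directionMGF (-v) = directionMGF v := directionMGF_eq_of_norm_eq (norm_neg v)
  rw [two_mul]
  nth_rewrite 2 [← hneg]
  unfold directionMGF
  have hv : Measurable fun x : E n => ENNReal.ofReal (Real.exp (inner ℝ (‖x‖⁻¹ • x) v)) :=
    measurable_exp_direction measurable_id measurable_const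
  rw [← lintegral_add_left hv]
  refine lintegral_congr fun x => ?_
  rw [← ENNReal.ofReal_add (Real.exp_nonneg _) (Real.exp_nonneg _), inner_neg_right,
    Real.cosh_eq]
  congr 1
  ring

theorem directionMGF_smul_le {n : ℕ} (v : E n) {s : ℝ} (hs : 0 ≤ s) (hs1 : s ≤ 1) :
    directionMGF (s • v) ≤ directionMGF v := by
  rw [← ENNReal.mul_le_mul_iff_right (a := 2) (by simp) (by simp), two_mul_directionMGF,
    two_mul_directionMGF]
  refine lintegral_mono fun x => ENNReal.ofReal_le_ofReal ?_
  gcongr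
  rw [Real.cosh_le_cosh, inner_smul_right, abs_mul, abs_of_nonneg hs]
  exact mul_le_of_le_one_left (abs_nonneg _) hs1

theorem directionMGF_mono {n : ℕ} {v v' : E n} (h : ‖v‖ ≤ ‖v'‖) :
    directionMGF v ≤ directionMGF v' := by
  rcases eq_or_ne v' 0 with rfl | hv'
  · rw [norm_zero, norm_le_zero_iff] at h
    rw [h]
  have hpos : 0 < ‖v'‖ := norm_pos_iff.mpr hv'
  have hnorm : ‖v‖ = ‖(‖v‖ / ‖v'‖) • v'‖ := by
    rw [norm_smul, Real.norm_of_nonneg (by positivity)]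
    field_simp
  rw [directionMGF_eq_of_norm_eq hnorm]
  exact directionMGF_smul_le v' (by positivity) ((div_le_one hpos).mpr h)

theorem directionMGF_zero {n : ℕ} :
    directionMGF (0 : E n) = volume (Metric.closedBall (0 : E n) 1) := by
  simp [directionMGF]

/-! ### Exponential lower bound -/

/-- The points of the ball of centre `2/(2+ε) v/‖v‖` and radius `ε/(2+ε)` lie in the unit ball, in
directions close to `v`. -/
theorem near_direction {n : ℕ} {ε : ℝ} (hε : ε ∈ Set.Ioo (0 : ℝ) 1) {v : E n} (hv : v ≠ 0)
    {x : E n}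
    (hx : x ∈ Metric.closedBall ((2 / (2 + ε) * ‖v‖⁻¹) • v) (ε / (2 + ε))) :
    ‖x‖ ≤ 1 ∧ (1 - ε) * ‖v‖ ≤ inner ℝ (‖x‖⁻¹ • x) v := by
  obtain ⟨h0, h1⟩ := hε
  have hvp : 0 < ‖v‖ := norm_pos_iff.mpr hv
  have h2 : 0 < 2 + ε := by linarith
  set c := (2 / (2 + ε) * ‖v‖⁻¹) • v with hc
  have hcn : ‖c‖ = 2 / (2 + ε) := by
    rw [hc, norm_smul, Real.norm_of_nonneg (by positivity)]
    field_simp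
  have hcv : inner ℝ c v = 2 / (2 + ε) * ‖v‖ := by
    rw [hc, inner_smul_left, real_inner_self_eq_norm_sq]
    simp only [conj_trivial]
    field_simp
  rw [Metric.mem_closedBall, dist_eq_norm] at hx
  have hxn : ‖x‖ ≤ 1 := by
    have : ‖x‖ ≤ ‖x - c‖ + ‖c‖ := by simpa using norm_add_le (x - c) c
    have h3 : ε / (2 + ε) + 2 / (2 + ε) = 1 := by field_simp; ring
    linarith
  have hxpos : 0 < ‖x‖ := by
    have : ‖c‖ ≤ ‖x - c‖ + ‖x‖ := by
      have := norm_sub_le x (x - c)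
      simp only [sub_sub_cancel] at this
      linarith
    have h3 : ε / (2 + ε) < 2 / (2 + ε) := by gcongr; linarith
    linarith
  have hinner : (2 - ε) / (2 + ε) * ‖v‖ ≤ inner ℝ x v := by
    have h3 : inner ℝ x v = inner ℝ (x - c) v + inner ℝ c v := by
      rw [← inner_add_left, sub_add_cancel]
    have h4 : -(‖x - c‖ * ‖v‖) ≤ inner ℝ (x - c) v :=
      (abs_le.mp (abs_real_inner_le_norm (x - c) v)).1
    have h5 : ‖x - c‖ * ‖v‖ ≤ ε / (2 + ε) * ‖v‖ := by gcongr
    have h6 : (2 - ε) / (2 + ε) * ‖v‖ = 2 / (2 + ε) * ‖v‖ - ε / (2 + ε) * ‖v‖ := by ring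
    linarith
  refine ⟨hxn, ?_⟩
  -- Normalizing `x` only helps, since `‖x‖ ≤ 1` and the lower bound is nonnegative.
  rw [inner_smul_left, conj_trivial, inv_mul_eq_div, le_div_iff₀ hxpos]
  refine le_trans ?_ hinner
  have h7 : (1 - ε) ≤ (2 - ε) / (2 + ε) := by
    rw [le_div_iff₀ h2]; nlinarith
  calc (1 - ε) * ‖v‖ * ‖x‖ ≤ (1 - ε) * ‖v‖ * 1 := by
        gcongr
    _ ≤ (2 - ε) / (2 + ε) * ‖v‖ := by rw [mul_one]; gcongr

theorem le_directionMGF {n : ℕ} {ε : ℝ} (hε : ε ∈ Set.Ioo (0 : ℝ) 1) {v : E n} (hv : v ≠ 0) :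
    ENNReal.ofReal (Real.exp ((1 - ε) * ‖v‖) * (ε / (2 + ε)) ^ n) *
      volume (Metric.closedBall (0 : E n) 1) ≤ directionMGF v := by
  have hr : 0 ≤ ε / (2 + ε) := by have := hε.1; positivity
  set B := Metric.closedBall ((2 / (2 + ε) * ‖v‖⁻¹) • v) (ε / (2 + ε)) with hB
  have hsub : B ⊆ Metric.closedBall 0 1 := fun x hx => by
    simpa using (near_direction hε hv hx).1
  have hvol : volume B = ENNReal.ofReal ((ε / (2 + ε)) ^ n) *
      volume (Metric.closedBall (0 : E n) 1) := by
    rw [hB, Measure.addHaar_closedBall' _ _ hr, finrank_euclideanSpace_fin]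
  calc _ = ∫⁻ _ in B, ENNReal.ofReal (Real.exp ((1 - ε) * ‖v‖)) := by
        rw [setLIntegral_const, hvol, ENNReal.ofReal_mul (Real.exp_nonneg _), mul_assoc]
    _ ≤ ∫⁻ x in B, ENNReal.ofReal (Real.exp (inner ℝ (‖x‖⁻¹ • x) v)) := by
        refine setLIntegral_mono' Metric.isClosed_closedBall.measurableSet fun x hx => ?_
        exact ENNReal.ofReal_le_ofReal (Real.exp_le_exp.mpr (near_direction hε hv hx).2)
    _ ≤ directionMGF v := lintegral_mono_set hsub

/-! ### Adding independent noise -/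

theorem IsSubGaussian.lintegral_exp_direction_le {Ω : Type*} [MeasurableSpace Ω]
    {μ : Measure Ω} [IsProbabilityMeasure μ] {n : ℕ} {X : Ω → E n} {s : ℝ}
    (hX : IsSubGaussian X s μ) (hs : 0 ≤ s) (a : ℝ) (x : E n) :
    ∫⁻ ω, ENNReal.ofReal (Real.exp (inner ℝ (‖x‖⁻¹ • x) (a • X ω))) ∂μ ≤
      ENNReal.ofReal (Real.exp (a ^ 2 * s / 2)) := by
  rcases eq_or_ne x 0 with rfl | hx
  -- At the origin the normalized direction is `0` by the convention `0⁻¹ = 0`, so the integrand is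
  -- `1`.
  · simp only [norm_zero, inv_zero, smul_zero, inner_zero_left, Real.exp_zero,
      lintegral_const, measure_univ, mul_one]
    exact ENNReal.ofReal_le_ofReal (Real.one_le_exp (by positivity))
  · have hx1 : ‖‖x‖⁻¹ • x‖ = 1 := by
      rw [norm_smul, norm_inv, norm_norm, inv_mul_cancel₀ (norm_ne_zero_iff.mpr hx)]
    simp only [inner_smul_right]
    rw [← ofReal_integral_eq_lintegral_ofReal (hX.integrable_exp a _ hx1)
      (.of_forall fun _ => Real.exp_nonneg _)]
    exact ENNReal.ofReal_le_ofReal (hX.mgf_le a _ hx1)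

/-- Adding an independent sub-Gaussian vector multiplies the averaged moment generating function
by at most the sub-Gaussian factor. -/
theorem lintegral_directionMGF_add_le {Ω : Type*} [MeasurableSpace Ω]
    {μ : Measure Ω} [IsProbabilityMeasure μ] {n : ℕ} {Y X : Ω → E n} {s : ℝ}
    (hY : Measurable Y) (hX : IsSubGaussian X s μ) (hs : 0 ≤ s) (hYX : IndepFun Y X μ) (a : ℝ) :
    ∫⁻ ω, directionMGF (a • (Y ω + X ω)) ∂μ ≤
      ENNReal.ofReal (Real.exp (a ^ 2 * s / 2)) * ∫⁻ ω, directionMGF (a • Y ω) ∂μ := by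
  have hmeas : ∀ {Z : Ω → E n}, Measurable Z → Measurable fun q : Ω × E n =>
      ENNReal.ofReal (Real.exp (inner ℝ (‖q.2‖⁻¹ • q.2) (a • Z q.1))) := fun hZ =>
    measurable_exp_direction measurable_snd ((hZ.comp measurable_fst).const_smul a)
  have hdir : ∀ x : E n, Measurable fun y : E n =>
      ENNReal.ofReal (Real.exp (inner ℝ (‖x‖⁻¹ • x) (a • y))) := fun x =>
    measurable_exp_direction measurable_const (measurable_id.const_smul a)
  unfold directionMGF
  -- Tonelli: once the direction is fixed, independence factors the exponential of the sum.
  rw [lintegral_lintegral_swap (hmeas (hY.add hX.measurable)).aemeasurable,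
    lintegral_lintegral_swap (f := fun ω (x : E n) =>
      ENNReal.ofReal (Real.exp (inner ℝ (‖x‖⁻¹ • x) (a • Y ω)))) (hmeas hY).aemeasurable,
    ← lintegral_const_mul _ (hmeas hY).lintegral_prod_left']
  refine lintegral_mono fun x => ?_
  have hsplit : ∀ ω, ENNReal.ofReal (Real.exp (inner ℝ (‖x‖⁻¹ • x) (a • (Y ω + X ω)))) =
      ENNReal.ofReal (Real.exp (inner ℝ (‖x‖⁻¹ • x) (a • Y ω))) *
        ENNReal.ofReal (Real.exp (inner ℝ (‖x‖⁻¹ • x) (a • X ω))) := fun ω => by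
    rw [← ENNReal.ofReal_mul (Real.exp_nonneg _), ← Real.exp_add, smul_add, inner_add_right]
  calc ∫⁻ ω, ENNReal.ofReal (Real.exp (inner ℝ (‖x‖⁻¹ • x) (a • (Y ω + X ω)))) ∂μ
      = ∫⁻ ω, ENNReal.ofReal (Real.exp (inner ℝ (‖x‖⁻¹ • x) (a • Y ω))) *
        ENNReal.ofReal (Real.exp (inner ℝ (‖x‖⁻¹ • x) (a • X ω))) ∂μ := lintegral_congr hsplit
    _ = (∫⁻ ω, ENNReal.ofReal (Real.exp (inner ℝ (‖x‖⁻¹ • x) (a • Y ω))) ∂μ) *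
        ∫⁻ ω, ENNReal.ofReal (Real.exp (inner ℝ (‖x‖⁻¹ • x) (a • X ω))) ∂μ :=
      lintegral_mul_eq_lintegral_mul_lintegral_of_indepFun ((hdir x).comp hY)
        ((hdir x).comp hX.measurable) (hYX.comp (hdir x) (hdir x))
    _ ≤ _ := by
      rw [mul_comm]
      gcongr
      exact hX.lintegral_exp_direction_le hs a x

/-! ### Propagation along the trajectory -/

theorem Psi_succ (L σ : ℕ → ℝ) (t : ℕ) :
    Psi L σ (t + 1) = σ t ^ 2 + L t ^ 2 * Psi L σ t := by
  unfold Psi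
  rw [Finset.sum_range_succ, Finset.Ico_self, Finset.prod_empty, mul_one, add_comm,
    Finset.mul_sum]
  congr 1
  refine Finset.sum_congr rfl fun k hk => ?_
  rw [Finset.prod_Ico_succ_top (Finset.mem_range.mp hk)]
  ring

theorem Psi_nonneg (L σ : ℕ → ℝ) (t : ℕ) : 0 ≤ Psi L σ t :=
  Finset.sum_nonneg fun _ _ => mul_nonneg (sq_nonneg _) (Finset.prod_nonneg fun _ _ => sq_nonneg _)

/-- The trajectory of the deterministic system from `x₀`. -/
def detTrajectory {n p : ℕ} (f : E n → E p → ℕ → E n) (u : ℕ → E p) (x₀ : E n) : ℕ → E n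
  | 0 => x₀
  | t + 1 => f (detTrajectory f u x₀ t) (u t) t

section Trajectory

variable {Ω : Type*} [MeasurableSpace Ω] {μ : Measure Ω} {n p : ℕ} {f : E n → E p → ℕ → E n}
  {w : ℕ → Ω → E n} {L σ : ℕ → ℝ}

theorem measurable_of_lipschitz
    (hf : ∀ (t : ℕ) (x y : E n) (u : E p), ‖f x u t - f y u t‖ ≤ L t * ‖x - y‖)
    (u : E p) (t : ℕ) : Measurable fun x => f x u t :=
  (LipschitzWith.of_dist_le' (K := L t) fun x y => by
    simpa only [dist_eq_norm] using hf t x y u).continuous.measurable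

/-- `X_{t+1}` is measurable with respect to `w_0, …, w_t`. -/
theorem measurable_natural_stochTrajectory
    (hf : ∀ (t : ℕ) (x y : E n) (u : E p), ‖f x u t - f y u t‖ ≤ L t * ‖x - y‖)
    (hw : ∀ t, StronglyMeasurable (w t)) (u : ℕ → E p) (x₀ : E n) (t : ℕ) :
    Measurable[Filtration.natural w hw t] (stochTrajectory f w u x₀ (t + 1)) := by
  have hwt : ∀ t, Measurable[Filtration.natural w hw t] (w t) := fun t =>
    (Filtration.stronglyAdapted_natural hw t).measurable
  induction t with
  | zero =>
    exact Measurable.add (m := Filtration.natural w hw 0) (f := fun _ => f x₀ (u 0) 0)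
      measurable_const (hwt 0)
  | succ t ih =>
    refine Measurable.add (m := Filtration.natural w hw (t + 1))
      (f := fun ω => f (stochTrajectory f w u x₀ (t + 1) ω) (u (t + 1)) (t + 1)) ?_ (hwt (t + 1))
    exact (measurable_of_lipschitz hf (u (t + 1)) (t + 1)).comp
      (ih.mono ((Filtration.natural w hw).mono t.le_succ) le_rfl)

theorem measurable_stochTrajectory
    (hf : ∀ (t : ℕ) (x y : E n) (u : E p), ‖f x u t - f y u t‖ ≤ L t * ‖x - y‖)
    (hw : ∀ t, Measurable (w t)) (u : ℕ → E p) (x₀ : E n) (t : ℕ) :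
    Measurable (stochTrajectory f w u x₀ t) := by
  cases t with
  | zero => exact measurable_const
  | succ t =>
    exact (measurable_natural_stochTrajectory hf (fun t => (hw t).stronglyMeasurable) u x₀ t).mono
      ((Filtration.natural w _).le t) le_rfl

theorem indepFun_stochTrajectory [IsProbabilityMeasure μ]
    (hf : ∀ (t : ℕ) (x y : E n) (u : E p), ‖f x u t - f y u t‖ ≤ L t * ‖x - y‖)
    (hw : ∀ t, Measurable (w t)) (hindep : iIndepFun w μ) (u : ℕ → E p) (x₀ : E n) (t : ℕ) :
    IndepFun (stochTrajectory f w u x₀ t) (w t) μ := by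
  cases t with
  | zero => exact indepFun_const_left x₀ (w 0)
  | succ t =>
    have h := hindep.indep_comap_natural_of_lt (fun t => (hw t).stronglyMeasurable) t.lt_succ_self
    exact (indep_of_indep_of_le_right h
      (measurable_natural_stochTrajectory hf _ u x₀ t).comap_le).symm

theorem lintegral_directionMGF_deviation_le [IsProbabilityMeasure μ] (hL : ∀ t, 0 ≤ L t)
    (hf : ∀ (t : ℕ) (x y : E n) (u : E p), ‖f x u t - f y u t‖ ≤ L t * ‖x - y‖)
    (hw : ∀ t, IsSubGaussian (w t) (σ t ^ 2) μ) (hindep : iIndepFun w μ)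
    (u : ℕ → E p) (x₀ : E n) (t : ℕ) (a : ℝ) :
    ∫⁻ ω, directionMGF (a • (stochTrajectory f w u x₀ t ω - detTrajectory f u x₀ t)) ∂μ ≤
      ENNReal.ofReal (Real.exp (a ^ 2 * Psi L σ t / 2)) *
        volume (Metric.closedBall (0 : E n) 1) := by
  -- The scale `a` must vary, because the Lipschitz step calls the induction hypothesis at `a * L
  -- t`.
  induction t generalizing a with
  | zero => simp [stochTrajectory, detTrajectory, Psi, directionMGF_zero]
  | succ t ih =>
    have hwm : ∀ t, Measurable (w t) := fun t => (hw t).measurable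
    set x := detTrajectory f u x₀ t with hx
    have hg : Measurable fun y => f y (u t) t - f x (u t) t :=
      (measurable_of_lipschitz hf (u t) t).sub_const _
    have hstep : ∀ ω, stochTrajectory f w u x₀ (t + 1) ω - detTrajectory f u x₀ (t + 1) =
        (f (stochTrajectory f w u x₀ t ω) (u t) t - f x (u t) t) + w t ω := fun ω => by
      simp only [stochTrajectory, detTrajectory, ← hx]
      abel
    simp only [hstep]
    refine (lintegral_directionMGF_add_le
      (hg.comp (measurable_stochTrajectory hf hwm u x₀ t)) (hw t) (sq_nonneg _)
      ((indepFun_stochTrajectory hf hwm hindep u x₀ t).comp hg measurable_id) a).trans ?_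
    have hcontr : ∫⁻ ω, directionMGF
          (a • (f (stochTrajectory f w u x₀ t ω) (u t) t - f x (u t) t)) ∂μ ≤
        ∫⁻ ω, directionMGF ((a * L t) • (stochTrajectory f w u x₀ t ω - x)) ∂μ := by
      refine lintegral_mono fun ω => directionMGF_mono ?_
      rw [norm_smul, norm_smul, norm_mul, mul_assoc, Real.norm_of_nonneg (hL t)]
      gcongr
      exact hf t _ _ _
    refine (mul_le_mul_right (hcontr.trans (ih (a * L t))) _).trans_eq ?_
    rw [← mul_assoc, ← ENNReal.ofReal_mul (Real.exp_nonneg _), ← Real.exp_add, Psi_succ]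
    congr 4
    ring

end Trajectory

/-! ### Tail bound -/

/-- A vector whose averaged moment generating function is sub-Gaussian with parameter `P` has
sub-Gaussian norm. -/
theorem measure_norm_gt_le {Ω : Type*} [MeasurableSpace Ω] {μ : Measure Ω} {n : ℕ} {V : Ω → E n}
    (hV : Measurable V) {P ε δ : ℝ} (hP : 0 < P) (hε : ε ∈ Set.Ioo (0 : ℝ) 1)
    (hδ : δ ∈ Set.Ioc (0 : ℝ) 1)
    (hmgf : ∀ a, ∫⁻ ω, directionMGF (a • V ω) ∂μ ≤ ENNReal.ofReal (Real.exp (a ^ 2 * P / 2)) *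
      volume (Metric.closedBall (0 : E n) 1)) :
    μ {ω | Real.sqrt (P * (eps₁ ε * n + eps₂ ε * Real.log (1 / δ))) < ‖V ω‖} ≤
      ENNReal.ofReal δ := by
  obtain ⟨h0, h1⟩ := hε
  obtain ⟨hd0, hd1⟩ := hδ
  have h1ε : 0 < 1 - ε := by linarith
  set M : ℝ := n * Real.log (1 + 2 / ε) + Real.log (1 / δ) with hM
  have hlog1 : 0 ≤ Real.log (1 + 2 / ε) := Real.log_nonneg (by have : 0 < 2 / ε := by positivity
                                                               linarith)
  have hlog2 : 0 ≤ Real.log (1 / δ) := Real.log_nonneg (by rw [le_div_iff₀ hd0]; linarith)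
  have hM0 : 0 ≤ M := by positivity
  have hK : eps₁ ε * n + eps₂ ε * Real.log (1 / δ) = 2 * M / (1 - ε) ^ 2 := by
    rw [eps₁, eps₂, hM]
    ring
  rw [hK]
  set ρ := Real.sqrt (P * (2 * M / (1 - ε) ^ 2)) with hρ
  have hρ0 : 0 ≤ ρ := Real.sqrt_nonneg _
  have hρ2 : ρ ^ 2 = P * (2 * M / (1 - ε) ^ 2) := Real.sq_sqrt (by positivity)
  -- This `a` minimizes the Chernoff exponent `a² P / 2 - (1 - ε) a ρ`, with minimum `-M`; then `exp
  -- (-M) (1 + 2/ε)ⁿ = δ`.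
  set a := ρ * (1 - ε) / P with ha
  have ha0 : 0 ≤ a := by positivity
  have haP : a ^ 2 * P / 2 = M := by
    have : a ^ 2 * P / 2 = ρ ^ 2 * (1 - ε) ^ 2 / (2 * P) := by rw [ha]; field_simp
    rw [this, hρ2]; field_simp
  have haρ : (1 - ε) * (a * ρ) = 2 * M := by
    have : (1 - ε) * (a * ρ) = ρ ^ 2 * (1 - ε) ^ 2 / P := by rw [ha]; field_simp
    rw [this, hρ2]; field_simp
  set b := volume (Metric.closedBall (0 : E n) 1) with hb
  have hb0 : b ≠ 0 := (Metric.measure_closedBall_pos _ _ one_pos).ne'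
  have hbtop : b ≠ ⊤ := measure_closedBall_lt_top.ne
  have hq : 0 < ε / (2 + ε) := by positivity
  set κ := Real.exp (2 * M) * (ε / (2 + ε)) ^ n with hκ
  have hκ0 : 0 < κ := by positivity
  have hlower : ∀ ω, ρ < ‖V ω‖ → ENNReal.ofReal κ * b ≤ directionMGF (a • V ω) := by
    intro ω hω
    have hVω : V ω ≠ 0 := norm_pos_iff.mp (hρ0.trans_lt hω)
    -- The case `a = 0` means `M = 0`; `le_directionMGF` needs a nonzero argument, but here `κ ≤ 1`
    -- suffices.
    rcases ha0.eq_or_lt with ha00 | hapos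
    · rw [← ha00, zero_smul, directionMGF_zero]
      refine mul_le_of_le_one_left' ?_
      rw [ENNReal.ofReal_le_one, hκ, ← haρ, ← ha00]
      simp only [zero_mul, mul_zero, Real.exp_zero, one_mul]
      exact pow_le_one₀ hq.le (by rw [div_le_one (by linarith)]; linarith)
    · refine le_trans ?_ (le_directionMGF ⟨h0, h1⟩ (smul_ne_zero hapos.ne' hVω))
      rw [norm_smul, Real.norm_of_nonneg ha0, hκ, ← haρ]
      gcongr
  have hmarkov : ENNReal.ofReal κ * b * μ {ω | ρ < ‖V ω‖} ≤ ENNReal.ofReal (Real.exp M) * b := by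
    calc _ ≤ ENNReal.ofReal κ * b * μ {ω | ENNReal.ofReal κ * b ≤ directionMGF (a • V ω)} := by
          exact mul_le_mul_right (measure_mono hlower) _
      _ ≤ ∫⁻ ω, directionMGF (a • V ω) ∂μ :=
          mul_meas_ge_le_lintegral (measurable_directionMGF.comp (hV.const_smul a)) _
      _ ≤ _ := haP ▸ hmgf a
  have hκδ : Real.exp M = κ * δ := by
    have hexp : Real.exp M * ((ε / (2 + ε)) ^ n * δ) = 1 := by
      have hbase : 1 + 2 / ε = (ε / (2 + ε))⁻¹ := by field_simp; ring
      rw [hM, Real.exp_add, Real.exp_nat_mul, Real.exp_log (by positivity),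
        Real.exp_log (by positivity), hbase, inv_pow]
      field_simp
    rw [hκ, two_mul, Real.exp_add M M]
    linear_combination -Real.exp M * hexp
  rw [hκδ, ENNReal.ofReal_mul hκ0.le, mul_right_comm (ENNReal.ofReal κ) _ b] at hmarkov
  exact (ENNReal.mul_le_mul_iff_right
    (mul_ne_zero (by simpa using hκ0) hb0) (ENNReal.mul_ne_top ENNReal.ofReal_ne_top hbtop)).mp
    hmarkov

/-- `measure_norm_gt_le`, with the degenerate parameter `P = 0` allowed. -/
theorem measure_norm_gt_le_of_nonneg {Ω : Type*} [MeasurableSpace Ω] {μ : Measure Ω} {n : ℕ}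
    {V : Ω → E n} (hV : Measurable V) {P ε δ : ℝ} (hP : 0 ≤ P) (hε : ε ∈ Set.Ioo (0 : ℝ) 1)
    (hδ : δ ∈ Set.Ioc (0 : ℝ) 1)
    (hmgf : ∀ a, ∫⁻ ω, directionMGF (a • V ω) ∂μ ≤ ENNReal.ofReal (Real.exp (a ^ 2 * P / 2)) *
      volume (Metric.closedBall (0 : E n) 1)) :
    μ {ω | Real.sqrt (P * (eps₁ ε * n + eps₂ ε * Real.log (1 / δ))) < ‖V ω‖} ≤
      ENNReal.ofReal δ := by
  rcases hP.eq_or_lt with rfl | hP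
  swap
  · exact measure_norm_gt_le hV hP hε hδ hmgf
  -- The bound for `P = 0` implies that for every `P > 0`. As `P ↓ 0` the radius tends to `0`, so
  -- each event `r ≤ ‖V‖` with `r > 0` has measure at most `δ`; continuity from below gives `0 <
  -- ‖V‖`.
  set K := eps₁ ε * n + eps₂ ε * Real.log (1 / δ)
  have hlim : Filter.Tendsto (fun P => Real.sqrt (P * K)) (nhdsWithin 0 (Set.Ioi 0))
      (nhds (Real.sqrt (0 * K))) :=
    ((Real.continuous_sqrt.comp (continuous_id.mul continuous_const)).tendsto 0).mono_left
      nhdsWithin_le_nhds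
  have hle : ∀ r : ℝ, 0 < r → μ {ω | r ≤ ‖V ω‖} ≤ ENNReal.ofReal δ := by
    intro r hr
    rw [zero_mul, Real.sqrt_zero] at hlim
    obtain ⟨P, hPr, hP⟩ := ((hlim.eventually (gt_mem_nhds hr)).and self_mem_nhdsWithin).exists
    refine (measure_mono fun ω hω => ?_).trans (measure_norm_gt_le hV hP hε hδ fun a =>
      (hmgf a).trans ?_)
    · exact lt_of_lt_of_le hPr hω
    · have := le_of_lt hP
      gcongr
  have hunion : {ω | Real.sqrt (0 * K) < ‖V ω‖} = ⋃ k : ℕ, {ω | 1 / ((k : ℝ) + 1) ≤ ‖V ω‖} := by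
    ext ω
    simp only [zero_mul, Real.sqrt_zero, Set.mem_ofPred_eq, Set.mem_iUnion]
    constructor
    · intro h
      obtain ⟨k, hk⟩ := exists_nat_one_div_lt h
      exact ⟨k, hk.le⟩
    · rintro ⟨k, hk⟩
      exact lt_of_lt_of_le (by positivity) hk
  have hmono : Monotone fun k : ℕ => {ω | 1 / ((k : ℝ) + 1) ≤ ‖V ω‖} := fun k l hkl ω hω =>
    le_trans (Nat.one_div_le_one_div hkl) (Set.mem_ofPred_eq ▸ hω)
  rw [hunion, hmono.measure_iUnion]
  exact iSup_le fun k => hle _ (by positivity)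

end StochReach

theorem theorem2 {Ω : Type*} [MeasurableSpace Ω] (μ : Measure Ω) [IsProbabilityMeasure μ]
    (n p : ℕ) (f : StochReach.E n → StochReach.E p → ℕ → StochReach.E n)
    (w : ℕ → Ω → StochReach.E n)
    (X₀ : Set (StochReach.E n)) (U : Set (StochReach.E p))
    (L σ : ℕ → ℝ) (hL : ∀ t, 0 ≤ L t) (hσ : ∀ t, 0 ≤ σ t)
    (hf : ∀ (t : ℕ) (x y : StochReach.E n) (u : StochReach.E p),
      ‖f x u t - f y u t‖ ≤ L t * ‖x - y‖)
    (hw : ∀ t, StochReach.IsSubGaussian (w t) (σ t ^ 2) μ)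
    (hindep : iIndepFun w μ)
    (t : ℕ) (ε δ : ℝ) (hε : ε ∈ Set.Ioo (0 : ℝ) 1) (hδ : δ ∈ Set.Ioc (0 : ℝ) 1)
    (Rbar : Set (StochReach.E n)) (hR : StochReach.detReachSet f X₀ U t ⊆ Rbar) :
    StochReach.IsProbReachSet μ f w X₀ U δ t
      (Rbar + Metric.closedBall (0 : StochReach.E n) (StochReach.radius n L σ ε δ t)) := by
  open StochReach in
  intro x₀ hx₀ u hu
  have hX := measurable_stochTrajectory hf (fun t => (hw t).measurable) u x₀ t
  set V : Ω → E n := fun ω => stochTrajectory f w u x₀ t ω - detTrajectory f u x₀ t with hVdef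
  have hV : Measurable V := hX.sub_const _
  have htail := measure_norm_gt_le_of_nonneg hV (Psi_nonneg L σ t) hε hδ
    (lintegral_directionMGF_deviation_le hL hf hw hindep u x₀ t)
  have hmeas : MeasurableSet {ω | radius n L σ ε δ t < ‖V ω‖} :=
    measurableSet_lt measurable_const hV.norm
  refine ⟨{ω | radius n L σ ε δ t < ‖V ω‖}ᶜ, hmeas.compl, fun ω hω => ?_, ?_⟩
  -- Off the tail event, the state is a deterministically reachable point plus the deviation `V ω`,
  -- which lies in the ball.
  · refine Set.mem_add.mpr ⟨detTrajectory f u x₀ t, hR ?_, V ω, ?_, ?_⟩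
    · exact ⟨detTrajectory f u x₀, u, fun _ => rfl, hx₀, hu, rfl⟩
    · simpa using hω
    · simp [hVdef]
  · rw [probReal_compl_eq_one_sub hmeas]
    have : μ.real {ω | radius n L σ ε δ t < ‖V ω‖} ≤ δ :=
      ENNReal.toReal_le_of_le_ofReal hδ.1.le htail
    linarith
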